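/- **Theorem 7.** Let $\alpha>0$ and let $w_\alpha(x)=x^\alpha \mathrm{e}^{-x}$ be the Laguerre weight on $(0,\infty)$. Let $p_n$, $n\ge 0$, be the polynomials orthonormal with respect to $w_\alpha$ on $(0,\infty)$, with $\deg p_n=n$ and positive leading coefficient, let $\varphi_n=\sqrt{w_\alpha}\,p_n$ be the corresponding W-functions, and let $D$ be the infinite differentiation matrix $$D_{m,n}=\int_0^\infty \varphi_m'(x)\varphi_n(x)\,\mathrm{d}x,\qquad m,n\ge 0 .$$ The power $D^k$, $k\ge 1$, is called bounded if its entries are well defined and finite, i.e. the integrals defining the entries of $D$ exist and, for all $m,n\ge 0$, the $(k-1)$-fold series $$\sum_{j_1=0}^\infty\cdots\sum_{j_{k-1}=0}^\infty D_{m,j_1}D_{j_1,j_2}\cdots D_{j_{k-1},n}$$ converges as a multiple series (the partial sums over the boxes $0\le j_i<N_i$ converge to a finite limit as $N_1,\dots,N_{k-1}\to\infty$ independently of each other). The index $\mathrm{ind}\,w_\alpha\in\mathbb{N}\cup\{\infty\}$ is the largest $s$ for which $D,D^2,\dots,D^s$ are bounded. Then, for every $s\in\mathbb{N}$, $$\mathrm{ind}\,w_\alpha\ge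 s\quad\Longleftrightarrow\quad \alpha>s-1 .$$ Moreover, if $\alpha>s-1$, then for $k=1,\dots,s$ and all $m,n\ge 0$ the above $(k-1)$-fold series converges absolutely. -/

import Mathlib

open Set Filter Topology MeasureTheory

noncomputable section

namespace WFun

/-- The inner product `∫_I p q w dx` of two polynomials for the weight `w` on the interval `I`. -/
def polyInner (I : Set ℝ) (w : ℝ → ℝ) (p q : Polynomial ℝ) : ℝ :=
  ∫ x in I, p.eval x * q.eval x * w x

/-- The orthonormal polynomials of the weight `w` on `I`: the Gram-Schmidt process applied to
`1, X, X ^ 2, …`; the leading coefficients are positive. -/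
def orthoPoly (I : Set ℝ) (w : ℝ → ℝ) (n : ℕ) : Polynomial ℝ :=
  let q : Polynomial ℝ := Polynomial.X ^ n -
    ∑ k : Fin n, Polynomial.C (polyInner I w (Polynomial.X ^ n) (orthoPoly I w k)) *
      orthoPoly I w k
  Polynomial.C (1 / √(polyInner I w q q)) * q
termination_by n
decreasing_by all_goals exact k.isLt

/-- The `n`-th W-function `φ_n = √w p_n`. -/
def wFunction (I : Set ℝ) (w : ℝ → ℝ) (n : ℕ) (x : ℝ) : ℝ :=
  √(w x) * (orthoPoly I w n).eval x

/-- The differentiation matrix `D_{m,n} = ∫_I φ_m' φ_n dx`. -/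
def diffMatrix (I : Set ℝ) (w : ℝ → ℝ) (m n : ℕ) : ℝ :=
  ∫ x in I, deriv (wFunction I w m) x * wFunction I w n x

/-- For `j = (j_1, …, j_r)`, the product `D_{m,j_1} D_{j_1,j_2} ⋯ D_{j_r,n}` of `r + 1` entries:
the general term of the `r`-fold series that defines the entry `(m, n)` of `D ^ (r + 1)`. -/
def pathProd (D : ℕ → ℕ → ℝ) (r : ℕ) (m n : ℕ) (j : Fin r → ℕ) : ℝ :=
  let v : Fin (r + 2) → ℕ :=
    Fin.cons (α := fun _ => ℕ) m (Fin.snoc (α := fun _ => ℕ) j n)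
  ∏ i : Fin (r + 1), D (v i.castSucc) (v i.succ)

/-- The `k`-th power of the infinite matrix `D` is bounded: for all `m, n` the `(k - 1)`-fold series
`∑_{j_1} ⋯ ∑_{j_{k-1}} D_{m,j_1} D_{j_1,j_2} ⋯ D_{j_{k-1},n}` converges to a finite value, as a
multiple series (partial sums over boxes `j_i < N_i`, the `N_i` tending to infinity independently
of each other). -/
def PowBounded (D : ℕ → ℕ → ℝ) : ℕ → Prop
  | 0 => True
  | r + 1 => ∀ m n : ℕ, ∃ L : ℝ,
      Tendsto (fun N : Fin r → ℕ =>
        ∑ j ∈ Fintype.piFinset (fun i => Finset.range (N i)), pathProd D r m n j) atTop (𝓝 L)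

/-- The `k`-th power of the infinite matrix `D` is absolutely bounded: for all `m, n` the
`(k - 1)`-fold series of `|D_{m,j_1} D_{j_1,j_2} ⋯ D_{j_{k-1},n}|` converges. -/
def PowAbsBounded (D : ℕ → ℕ → ℝ) : ℕ → Prop
  | 0 => True
  | r + 1 => ∀ m n : ℕ, Summable fun j : Fin r → ℕ => |pathProd D r m n j|

/-- All the integrals that define the entries of the differentiation matrix exist. -/
def EntriesExist (I : Set ℝ) (w : ℝ → ℝ) : Prop :=
  ∀ m n : ℕ, IntegrableOn (fun x => deriv (wFunction I w m) x * wFunction I w n x) I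

/-- The index of the weight `w` on `I`: the largest `s` in `ℕ ∪ {∞}` such that the powers
`D, …, D ^ s` of the differentiation matrix are bounded. -/
def index (I : Set ℝ) (w : ℝ → ℝ) : ℕ∞ :=
  sSup {s : ℕ∞ | ∀ k : ℕ, 1 ≤ k → (k : ℕ∞) ≤ s →
    EntriesExist I w ∧ PowBounded (diffMatrix I w) k}

/-- The Laguerre weight `w_α(x) = x ^ α e ^ (-x)`, considered on `(0, ∞)`. -/
def laguerreWeight (α : ℝ) (x : ℝ) : ℝ := x ^ α * Real.exp (-x)

end WFun

end

/-! The matrix `D` is antisymmetric, and above the diagonal it separates: for `m < n`, `D_{m,n} = ½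
(-1)^(m+n) h_m / h_n` with `h_n ^ 2 = g_n = Γ(α+1+n)/n!`, a sequence growing like `n ^ α`
(`diffMatrix_laguerreWeight_of_lt`, `eventually_gammaGrowth_bounds`). Everything else is a study of
products of such entries along paths `m, j_1, …, j_r, n`.

Convergence for `α > r`: since `|D_{m,n}| ≤ min (h_m/h_n, h_n/h_m)`, a path product telescopes to at
most `h_m h_n / g_{j_i}` for each `i`. The geometric mean of these `r` bounds is a product of
one-variable functions decaying like `j_i ^ (-α/r)`, hence summable.

Divergence for `α ≤ r`: on increasing paths that start at `0` and finally return to `0`, all terms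
are negative and equal a constant over `g_{j_r}`. A box of `K ^ r` such paths at distance of order
`K` has a sum of modulus at least a constant times `K ^ (r-α)`, whereas convergence of the multiple
series forces box sums at infinity to tend to `0` (`tendsto_sum_mixedBox`). -/

noncomputable section

namespace WFun

open Polynomial

/-! ### Gamma moments and monic Laguerre polynomials -/

/-- The linear functional `X ^ k ↦ Γ (k + a)` on polynomials. -/
def gammaMoment (a : ℝ) : ℝ[X] →ₗ[ℝ] ℝ :=
  Polynomial.lsum fun k => Real.Gamma (k + a) • LinearMap.id

theorem gammaMoment_monomial (a : ℝ) (k : ℕ) (c : ℝ) :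
    gammaMoment a (monomial k c) = Real.Gamma (k + a) * c := by
  simp [gammaMoment, Polynomial.lsum_apply, Polynomial.sum_monomial_index]

theorem gammaMoment_C_mul (a c : ℝ) (p : ℝ[X]) : gammaMoment a (C c * p) = c * gammaMoment a p := by
  rw [← smul_eq_C_mul, map_smul, smul_eq_mul]

theorem degree_C_mul_le_self (c : ℝ) (p : ℝ[X]) : (C c * p).degree ≤ p.degree := by
  rw [← smul_eq_C_mul]
  exact degree_smul_le c p

theorem integrableOn_and_integral_eval_mul_rpow_mul_exp {a : ℝ} (ha : 0 < a) (P : ℝ[X]) :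
    IntegrableOn (fun x => P.eval x * (x ^ (a - 1) * Real.exp (-x))) (Ioi 0) ∧
      ∫ x in Ioi 0, P.eval x * (x ^ (a - 1) * Real.exp (-x)) = gammaMoment a P := by
  induction P using Polynomial.induction_on' with
  | add p q hp hq =>
    have h : (fun x : ℝ => (p + q).eval x * (x ^ (a - 1) * Real.exp (-x))) = fun x =>
        p.eval x * (x ^ (a - 1) * Real.exp (-x)) + q.eval x * (x ^ (a - 1) * Real.exp (-x)) := by
      funext x
      rw [eval_add, add_mul]
    rw [h, map_add, ← hp.2, ← hq.2]
    exact ⟨hp.1.add hq.1, integral_add hp.1 hq.1⟩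
  | monomial n c =>
    have hpos : 0 < (n : ℝ) + a := by positivity
    have h : EqOn (fun x : ℝ => c * (Real.exp (-x) * x ^ ((n : ℝ) + a - 1)))
        (fun x : ℝ => (monomial n c).eval x * (x ^ (a - 1) * Real.exp (-x))) (Ioi 0) := by
      intro x hx
      have hx : 0 < x := hx
      simp only [eval_monomial]
      rw [show (n : ℝ) + a - 1 = n + (a - 1) by ring, Real.rpow_add hx, Real.rpow_natCast]
      ring
    refine ⟨IntegrableOn.congr_fun ((Real.GammaIntegral_convergent hpos).const_mul c) h
      measurableSet_Ioi, ?_⟩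
    rw [← setIntegral_congr_fun measurableSet_Ioi h, integral_const_mul,
      ← Real.Gamma_eq_integral hpos, gammaMoment_monomial, mul_comm]

/-- After `Γ(z+1) = zΓ(z)`, each difference contributes the factor `(x+k+j) - (x+j+n) = k - n`. For
a natural number `k < n` the product vanishes, which is the source of orthogonality. -/
theorem fwdDiff_iter_Gamma_div {x k : ℝ} (hx : 0 < x) (hk : 0 < x + k) (n j : ℕ) :
    (fwdDiff 1)^[n] (fun j : ℕ => Real.Gamma (x + k + j) / Real.Gamma (x + j)) j =
      (∏ i ∈ Finset.range n, (k - i)) * (Real.Gamma (x + k + j) / Real.Gamma (x + j + n)) := by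
  induction n generalizing j with
  | zero => simp
  | succ n ih =>
    rw [Function.iterate_succ', Function.comp_apply, fwdDiff, ih, ih, Finset.prod_range_succ]
    have h1 : x + k + j ≠ 0 := by positivity
    have h2 : x + j + n ≠ 0 := by positivity
    have h3 : Real.Gamma (x + j + n) ≠ 0 := (Real.Gamma_pos_of_pos (by positivity)).ne'
    push_cast
    rw [show x + k + ((j : ℝ) + 1) = x + k + j + 1 by ring,
      show x + ((j : ℝ) + 1) + n = x + j + n + 1 by ring,
      show x + (j : ℝ) + (n + 1) = x + j + n + 1 by ring,
      Real.Gamma_add_one h1, Real.Gamma_add_one h2]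
    field_simp
    ring

/-- The monic Laguerre polynomials. -/
def monicLaguerre (a : ℝ) (n : ℕ) : ℝ[X] :=
  ∑ j ∈ Finset.range (n + 1), monomial j
    ((-1) ^ (n - j) * n.choose j * (Real.Gamma (a + 1 + n) / Real.Gamma (a + 1 + j)))

/-- The alternating binomial sum is an `n`-th difference with `k = l - 1`. The value is `0` for `1 ≤
l ≤ n`; the case `l = 0`, with the weight `x^(a-1) e^(-x)`, does not vanish and produces the matrix
entries. -/
theorem gammaMoment_X_pow_mul_monicLaguerre {a : ℝ} (ha : 0 < a) (l n : ℕ) :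
    gammaMoment a (X ^ l * monicLaguerre a n) =
      (∏ i ∈ Finset.range n, ((l : ℝ) - 1 - i)) * Real.Gamma (l + a) := by
  have h := fwdDiff_iter_Gamma_div (x := a + 1) (k := l - 1) (by positivity)
    (by ring_nf; positivity) n 0
  rw [fwdDiff_iter_eq_sum_shift] at h
  have hG : Real.Gamma (a + 1 + n) ≠ 0 := (Real.Gamma_pos_of_pos (by positivity)).ne'
  have h2 : gammaMoment a (X ^ l * monicLaguerre a n) = Real.Gamma (a + 1 + n) *
      ((∏ i ∈ Finset.range n, ((l : ℝ) - 1 - i)) *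
        (Real.Gamma (a + 1 + (l - 1) + (0 : ℕ)) / Real.Gamma (a + 1 + (0 : ℕ) + n))) := by
    rw [← h, monicLaguerre, Finset.mul_sum, map_sum, Finset.mul_sum]
    refine Finset.sum_congr rfl fun j _ => ?_
    rw [X_pow_mul_monomial, gammaMoment_monomial]
    simp only [zero_add, smul_eq_mul, mul_one, zsmul_eq_mul]
    push_cast
    rw [show a + 1 + ((l : ℝ) - 1) + j = j + l + a by ring]
    ring
  rw [h2, Nat.cast_zero, add_zero, add_zero, show a + 1 + ((l : ℝ) - 1) = l + a by ring]
  field_simp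

theorem gammaMoment_monicLaguerre {a : ℝ} (ha : 0 < a) (n : ℕ) :
    gammaMoment a (monicLaguerre a n) = (-1) ^ n * n.factorial * Real.Gamma a := by
  have h := gammaMoment_X_pow_mul_monicLaguerre ha 0 n
  rw [pow_zero, one_mul] at h
  rw [h, Nat.cast_zero, zero_add]
  congr 1
  induction n with
  | zero => simp
  | succ n ih =>
    rw [Finset.prod_range_succ, ih (by simpa using gammaMoment_X_pow_mul_monicLaguerre ha 0 n),
      Nat.factorial_succ]
    push_cast
    ring

theorem gammaMoment_X_mul_mul_monicLaguerre_of_degree_lt {a : ℝ} (ha : 0 < a) {n : ℕ} {p : ℝ[X]}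
    (hp : p.degree < n) : gammaMoment a (X * p * monicLaguerre a n) = 0 := by
  have hp' : X * p * monicLaguerre a n =
      ∑ i ∈ Finset.range n, p.coeff i • (X ^ (i + 1) * monicLaguerre a n) := by
    have hdeg : p.natDegree < n ∨ p = 0 := by
      by_cases h : p = 0
      · exact Or.inr h
      · exact Or.inl ((natDegree_lt_iff_degree_lt h).2 hp)
    rcases hdeg with hdeg | rfl
    · conv_lhs => rw [p.as_sum_range' n hdeg]
      rw [Finset.mul_sum, Finset.sum_mul]
      refine Finset.sum_congr rfl fun i _ => ?_
      rw [← C_mul_X_pow_eq_monomial, smul_eq_C_mul]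
      ring
    · simp
  rw [hp', map_sum]
  refine Finset.sum_eq_zero fun i hi => ?_
  rw [map_smul, gammaMoment_X_pow_mul_monicLaguerre ha, Finset.prod_eq_zero hi, zero_mul, smul_zero]
  push_cast
  ring

theorem coeff_monicLaguerre (a : ℝ) (n k : ℕ) : (monicLaguerre a n).coeff k = if k ≤ n then
    (-1) ^ (n - k) * n.choose k * (Real.Gamma (a + 1 + n) / Real.Gamma (a + 1 + k)) else 0 := by
  simp [monicLaguerre, coeff_monomial, Order.lt_add_one_iff]

theorem eval_zero_monicLaguerre (a : ℝ) (n : ℕ) : (monicLaguerre a n).eval 0 =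
    (-1) ^ n * (Real.Gamma (a + 1 + n) / Real.Gamma (a + 1)) := by
  rw [← coeff_zero_eq_eval_zero, coeff_monicLaguerre]
  simp

theorem degree_monicLaguerre_sub_X_pow_lt {a : ℝ} (ha : 0 < a) (n : ℕ) :
    (monicLaguerre a n - X ^ n).degree < (n : WithBot ℕ) := by
  rw [degree_lt_iff_coeff_zero]
  intro m hm
  have hG : Real.Gamma (a + 1 + n) ≠ 0 := (Real.Gamma_pos_of_pos (by positivity)).ne'
  rw [coeff_sub, coeff_monicLaguerre, coeff_X_pow]
  rcases hm.eq_or_lt with rfl | h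
  · simp [hG]
  · simp [h.not_ge, h.ne']

theorem degree_monicLaguerre_le {a : ℝ} (n : ℕ) : (monicLaguerre a n).degree ≤ n := by
  rw [degree_le_iff_coeff_zero]
  intro m hm
  rw [coeff_monicLaguerre, if_neg]
  exact_mod_cast hm.not_ge

theorem gammaMoment_X_mul_X_pow_mul_monicLaguerre {a : ℝ} (ha : 0 < a) (n : ℕ) :
    gammaMoment a (X * X ^ n * monicLaguerre a n) = n.factorial * Real.Gamma (a + 1 + n) := by
  rw [← pow_succ', gammaMoment_X_pow_mul_monicLaguerre ha]
  push_cast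
  rw [show (n : ℝ) + 1 + a = a + 1 + n by ring, ← Finset.prod_range_reflect,
    ← Finset.prod_range_add_one_eq_factorial]
  congr 1
  push_cast
  refine Finset.prod_congr rfl fun i hi => ?_
  rw [Finset.mem_range] at hi
  rw [Nat.sub_sub, Nat.cast_sub (by omega)]
  push_cast
  ring

/-! ### Identification of the orthonormal polynomials -/

theorem polyInner_laguerreWeight {a : ℝ} (ha : 0 < a) (p q : ℝ[X]) :
    polyInner (Ioi 0) (laguerreWeight a) p q = gammaMoment a (X * p * q) := by
  rw [polyInner, ← (integrableOn_and_integral_eval_mul_rpow_mul_exp ha _).2]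
  refine setIntegral_congr_fun measurableSet_Ioi fun x hx => ?_
  have hx : 0 < x := hx
  simp only [laguerreWeight, eval_mul, eval_X]
  rw [Real.rpow_sub_one hx.ne']
  field_simp

/-- The squared norm of the monic Laguerre polynomial. -/
def laguerreNormSq (a : ℝ) (n : ℕ) : ℝ := n.factorial * Real.Gamma (a + 1 + n)

theorem laguerreNormSq_pos {a : ℝ} (ha : 0 < a) (n : ℕ) : 0 < laguerreNormSq a n :=
  mul_pos (by positivity) (Real.Gamma_pos_of_pos (by positivity))

/-- The orthonormal Laguerre polynomials. -/
def normLaguerre (a : ℝ) (n : ℕ) : ℝ[X] := C (1 / √(laguerreNormSq a n)) * monicLaguerre a n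

theorem gammaMoment_X_mul_monicLaguerre_self {a : ℝ} (ha : 0 < a) (n : ℕ) :
    gammaMoment a (X * monicLaguerre a n * monicLaguerre a n) = laguerreNormSq a n := by
  rw [laguerreNormSq, ← gammaMoment_X_mul_X_pow_mul_monicLaguerre ha, ← sub_eq_zero, ← map_sub,
    ← gammaMoment_X_mul_mul_monicLaguerre_of_degree_lt ha (degree_monicLaguerre_sub_X_pow_lt ha n)]
  congr 1
  ring

theorem gammaMoment_X_mul_normLaguerre (a : ℝ) (p : ℝ[X]) (n : ℕ) :
    gammaMoment a (X * p * normLaguerre a n) =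
      1 / √(laguerreNormSq a n) * gammaMoment a (X * p * monicLaguerre a n) := by
  rw [normLaguerre, ← gammaMoment_C_mul]
  congr 1
  ring

theorem gammaMoment_X_mul_mul_normLaguerre_of_degree_lt {a : ℝ} (ha : 0 < a) {n : ℕ} {p : ℝ[X]}
    (hp : p.degree < n) : gammaMoment a (X * p * normLaguerre a n) = 0 := by
  rw [gammaMoment_X_mul_normLaguerre, gammaMoment_X_mul_mul_monicLaguerre_of_degree_lt ha hp,
    mul_zero]

theorem degree_normLaguerre_le (a : ℝ) (n : ℕ) : (normLaguerre a n).degree ≤ n :=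
  (degree_C_mul_le_self _ _).trans (degree_monicLaguerre_le n)

theorem eq_sum_normLaguerre {a : ℝ} (ha : 0 < a) {n : ℕ} {p : ℝ[X]} (hp : p.degree < n) :
    p = ∑ k ∈ Finset.range n, C (gammaMoment a (X * p * normLaguerre a k)) * normLaguerre a k := by
  induction n generalizing p with
  | zero => simpa using hp
  | succ n ih =>
    set c := p.coeff n
    have hr : (p - C c * monicLaguerre a n).degree < n := by
      rw [degree_lt_iff_coeff_zero] at hp ⊢
      intro m hm
      rw [coeff_sub, coeff_C_mul]
      have h := (degree_lt_iff_coeff_zero _ _).1 (degree_monicLaguerre_sub_X_pow_lt ha n) m hm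
      rw [coeff_sub, sub_eq_zero] at h
      rw [h, coeff_X_pow]
      rcases hm.eq_or_lt with rfl | h
      · simp [c]
      · simp [h.ne', hp m h]
    have h1 : gammaMoment a (X * p * monicLaguerre a n) = c * laguerreNormSq a n := by
      rw [← gammaMoment_X_mul_monicLaguerre_self ha, ← sub_eq_zero, ← gammaMoment_C_mul,
        ← map_sub, ← gammaMoment_X_mul_mul_monicLaguerre_of_degree_lt ha hr]
      congr 1
      ring
    have h2 : C (gammaMoment a (X * p * normLaguerre a n)) * normLaguerre a n =
        C c * monicLaguerre a n := by
      rw [gammaMoment_X_mul_normLaguerre, h1, normLaguerre, ← mul_assoc, ← C_mul]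
      congr 2
      have := laguerreNormSq_pos ha n
      field_simp
      rw [Real.sq_sqrt this.le, mul_comm]
    have h3 : ∀ k ∈ Finset.range n,
        C (gammaMoment a (X * p * normLaguerre a k)) * normLaguerre a k =
        C (gammaMoment a (X * (p - C c * monicLaguerre a n) * normLaguerre a k)) *
          normLaguerre a k := by
      intro k hk
      congr 2
      have h4 : (C c * normLaguerre a k).degree < n :=
        ((degree_C_mul_le_self _ _).trans (degree_normLaguerre_le a k)).trans_lt
          (by exact_mod_cast Finset.mem_range.1 hk)
      rw [← sub_eq_zero, ← map_sub, ← gammaMoment_X_mul_mul_monicLaguerre_of_degree_lt ha h4]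
      congr 1
      ring
    rw [Finset.sum_range_succ, h2, Finset.sum_congr rfl h3, ← ih hr]
    ring

theorem orthoPoly_laguerreWeight {a : ℝ} (ha : 0 < a) (n : ℕ) :
    orthoPoly (Ioi 0) (laguerreWeight a) n = normLaguerre a n := by
  induction n using Nat.strong_induction_on with
  | _ n ih =>
    have hq : X ^ n - ∑ k : Fin n, C (polyInner (Ioi 0) (laguerreWeight a) (X ^ n)
        (orthoPoly (Ioi 0) (laguerreWeight a) k)) * orthoPoly (Ioi 0) (laguerreWeight a) k =
        monicLaguerre a n := by
      have h1 := eq_sum_normLaguerre ha (degree_monicLaguerre_sub_X_pow_lt ha n)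
      -- The monic Laguerre polynomial is orthogonal to lower degrees, so `X ^ n` and its difference
      -- from that polynomial have the same coefficients up to sign.
      have h2 : ∑ k : Fin n, C (polyInner (Ioi 0) (laguerreWeight a) (X ^ n)
          (orthoPoly (Ioi 0) (laguerreWeight a) k)) * orthoPoly (Ioi 0) (laguerreWeight a) k =
          -(monicLaguerre a n - X ^ n) := by
        rw [h1, Finset.sum_range, ← Finset.sum_neg_distrib]
        refine Finset.sum_congr rfl fun k _ => ?_
        rw [ih k k.2, polyInner_laguerreWeight ha, ← neg_mul, ← C_neg, ← map_neg]
        congr 2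
        have h4 : (normLaguerre a k).degree < n :=
          (degree_normLaguerre_le a k).trans_lt (by exact_mod_cast k.2)
        rw [← sub_eq_zero, ← map_sub, ← gammaMoment_X_mul_mul_monicLaguerre_of_degree_lt ha h4]
        congr 1
        ring
      rw [h2]
      ring
    rw [orthoPoly, hq, polyInner_laguerreWeight ha, gammaMoment_X_mul_monicLaguerre_self ha,
      normLaguerre]

/-! ### Entries of the differentiation matrix -/

theorem deriv_wFunction_mul_wFunction_laguerreWeight {a : ℝ} (ha : 0 < a) (m n : ℕ) {x : ℝ}
    (hx : 0 < x) :
    deriv (wFunction (Ioi 0) (laguerreWeight a) m) x * wFunction (Ioi 0) (laguerreWeight a) n x =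
      (X * derivative (normLaguerre a m) * normLaguerre a n +
        C (1 / 2) * ((C a - X) * normLaguerre a m * normLaguerre a n)).eval x *
        (x ^ (a - 1) * Real.exp (-x)) := by
  have hw : 0 < laguerreWeight a x := mul_pos (Real.rpow_pos_of_pos hx a) (Real.exp_pos _)
  have h1 : HasDerivAt (laguerreWeight a) (x ^ (a - 1) * Real.exp (-x) * (a - x)) x := by
    have h2 : HasDerivAt (fun y : ℝ => Real.exp (-y)) (Real.exp (-x) * -1) x :=
      (hasDerivAt_neg x).exp
    refine ((Real.hasDerivAt_rpow_const (p := a) (Or.inl hx.ne')).mul h2).congr_deriv ?_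
    rw [Real.rpow_sub_one hx.ne']
    field_simp
    ring
  have h3 := (h1.sqrt hw.ne').mul ((orthoPoly (Ioi 0) (laguerreWeight a) m).hasDerivAt x)
  have h4 : deriv (wFunction (Ioi 0) (laguerreWeight a) m) x = _ := h3.deriv
  have hs : √(laguerreWeight a x) ≠ 0 := (Real.sqrt_pos.2 hw).ne'
  have hs2 : √(laguerreWeight a x) * √(laguerreWeight a x) =
      x * (x ^ (a - 1) * Real.exp (-x)) := by
    rw [Real.mul_self_sqrt hw.le, laguerreWeight, Real.rpow_sub_one hx.ne']
    field_simp
  rw [h4, wFunction, orthoPoly_laguerreWeight ha, orthoPoly_laguerreWeight ha]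
  simp only [eval_add, eval_mul, eval_sub, eval_X, eval_C]
  generalize √(laguerreWeight a x) = t at hs hs2 ⊢
  generalize x ^ (a - 1) * Real.exp (-x) = u at hs2 ⊢
  generalize eval x (normLaguerre a m) = p
  generalize eval x (normLaguerre a n) = q
  generalize eval x (derivative (normLaguerre a m)) = r
  calc (u * (a - x) / (2 * t) * p + t * r) * (t * q)
      = u * (a - x) / 2 * p * q + t * t * r * q := by field_simp
    _ = _ := by rw [hs2]; ring

theorem entriesExist_laguerreWeight {a : ℝ} (ha : 0 < a) :
    EntriesExist (Ioi 0) (laguerreWeight a) := fun m n =>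
  (integrableOn_and_integral_eval_mul_rpow_mul_exp ha _).1.congr_fun
    (fun _ hx => (deriv_wFunction_mul_wFunction_laguerreWeight ha m n hx).symm) measurableSet_Ioi

theorem diffMatrix_eq_gammaMoment {a : ℝ} (ha : 0 < a) (m n : ℕ) :
    diffMatrix (Ioi 0) (laguerreWeight a) m n =
      gammaMoment a (X * derivative (normLaguerre a m) * normLaguerre a n +
        C (1 / 2) * ((C a - X) * normLaguerre a m * normLaguerre a n)) := by
  rw [diffMatrix, ← (integrableOn_and_integral_eval_mul_rpow_mul_exp ha _).2]
  exact setIntegral_congr_fun measurableSet_Ioi fun _ hx =>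
    deriv_wFunction_mul_wFunction_laguerreWeight ha m n hx

/-- Integration by parts in algebraic form: times `x^(a-1) e^(-x)`, the polynomial is the derivative
of `p x^a e^(-x)`, which vanishes at both ends. On monomials it is the recurrence of `Γ`. -/
theorem gammaMoment_X_mul_derivative {a : ℝ} (ha : 0 < a) (p : ℝ[X]) :
    gammaMoment a (X * derivative p + (C a - X) * p) = 0 := by
  induction p using Polynomial.induction_on' with
  | add p q hp hq =>
    have h : X * derivative (p + q) + (C a - X) * (p + q) =
        (X * derivative p + (C a - X) * p) + (X * derivative q + (C a - X) * q) := by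
      rw [derivative_add]
      ring
    rw [h, map_add, hp, hq, add_zero]
  | monomial n c =>
    have h : X * derivative (monomial n c) + (C a - X) * monomial n c =
        monomial n (c * (n + a)) - monomial (n + 1) c := by
      rw [sub_mul, X_mul_monomial, C_mul_monomial, derivative_monomial]
      rcases n with _ | n
      · simp [mul_comm]
      · rw [X_mul_monomial, Nat.add_sub_cancel, Nat.cast_succ, mul_comm a c,
          mul_add c (n + 1 : ℝ) a, map_add]
        ring
    have hn : (n : ℝ) + a ≠ 0 := by positivity
    rw [h, map_sub, gammaMoment_monomial, gammaMoment_monomial]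
    push_cast
    rw [show (n : ℝ) + 1 + a = n + a + 1 by ring, Real.Gamma_add_one hn]
    ring

theorem diffMatrix_laguerreWeight_antisymm {a : ℝ} (ha : 0 < a) (m n : ℕ) :
    diffMatrix (Ioi 0) (laguerreWeight a) m n = -diffMatrix (Ioi 0) (laguerreWeight a) n m := by
  rw [diffMatrix_eq_gammaMoment ha, diffMatrix_eq_gammaMoment ha, eq_neg_iff_add_eq_zero,
    ← map_add, ← gammaMoment_X_mul_derivative ha (normLaguerre a m * normLaguerre a n),
    derivative_mul]
  congr 1
  have : (C (1 / 2 : ℝ) : ℝ[X]) + C (1 / 2) = 1 := by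
    rw [← C_add]
    norm_num
  linear_combination ((C a - X) * normLaguerre a m * normLaguerre a n) * this

/-- The sequence `Γ (n + a + 1) / n!`, which grows like `n ^ a`. -/
def gammaGrowth (a : ℝ) (n : ℕ) : ℝ := Real.Gamma (a + 1 + n) / n.factorial

theorem gammaGrowth_pos {a : ℝ} (ha : 0 < a) (n : ℕ) : 0 < gammaGrowth a n :=
  div_pos (Real.Gamma_pos_of_pos (by positivity)) (by positivity)

theorem eval_zero_normLaguerre {a : ℝ} (ha : 0 < a) (n : ℕ) :
    (normLaguerre a n).eval 0 = (-1) ^ n * √(gammaGrowth a n) / Real.Gamma (a + 1) := by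
  have hG : 0 < Real.Gamma (a + 1 + n) := Real.Gamma_pos_of_pos (by positivity)
  have hG1 : 0 < Real.Gamma (a + 1) := Real.Gamma_pos_of_pos (by positivity)
  have hf : 0 < (n.factorial : ℝ) := by positivity
  rw [normLaguerre, eval_mul, eval_C, eval_zero_monicLaguerre, gammaGrowth, laguerreNormSq,
    Real.sqrt_mul hf.le, Real.sqrt_div hG.le]
  have h1 := Real.sqrt_pos.2 hG
  have h2 := Real.sqrt_pos.2 hf
  field_simp
  rw [Real.sq_sqrt hG.le]

theorem gammaMoment_normLaguerre {a : ℝ} (ha : 0 < a) (n : ℕ) :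
    gammaMoment a (normLaguerre a n) = (-1) ^ n * Real.Gamma a / √(gammaGrowth a n) := by
  have hG : 0 < Real.Gamma (a + 1 + n) := Real.Gamma_pos_of_pos (by positivity)
  have hf : 0 < (n.factorial : ℝ) := by positivity
  rw [normLaguerre, gammaMoment_C_mul, gammaMoment_monicLaguerre ha, gammaGrowth, laguerreNormSq,
    Real.sqrt_mul hf.le, Real.sqrt_div hG.le]
  have h1 := Real.sqrt_pos.2 hG
  have h2 := Real.sqrt_pos.2 hf
  field_simp
  rw [Real.sq_sqrt hf.le]

/-- Writing `p_m = p_m(0) + X * divX p_m`, orthogonality of `p_n` to lower degrees kills every term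
except `(a/2) p_m(0)` times the moment of `p_n`: a factor in `m` times a factor in `n`. -/
theorem diffMatrix_laguerreWeight_of_lt {a : ℝ} (ha : 0 < a) {m n : ℕ} (h : m < n) :
    diffMatrix (Ioi 0) (laguerreWeight a) m n =
      1 / 2 * (-1) ^ (m + n) * (√(gammaGrowth a m) / √(gammaGrowth a n)) := by
  have hm : (normLaguerre a m).degree < n :=
    (degree_normLaguerre_le a m).trans_lt (by exact_mod_cast h)
  have hm' : (derivative (normLaguerre a m)).degree < n :=
    (degree_derivative_le).trans_lt hm
  have hd : (divX (normLaguerre a m)).degree < n := by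
    rcases eq_or_ne (normLaguerre a m) 0 with h0 | h0
    · rwa [h0, divX_zero, ← h0]
    · exact (degree_divX_lt h0).trans hm
  have key : X * derivative (normLaguerre a m) * normLaguerre a n +
      C (1 / 2) * ((C a - X) * normLaguerre a m * normLaguerre a n) =
      X * derivative (normLaguerre a m) * normLaguerre a n +
      (C (a / 2) * (X * divX (normLaguerre a m) * normLaguerre a n) +
      C (a / 2 * (normLaguerre a m).eval 0) * normLaguerre a n
        - C (1 / 2) * (X * normLaguerre a m * normLaguerre a n)) := by
    have h1 := X_mul_divX_add (normLaguerre a m)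
    rw [coeff_zero_eq_eval_zero] at h1
    have h2 : (C (a / 2) : ℝ[X]) = C a * C (1 / 2) := by rw [← C_mul]; congr 1; ring
    rw [C_mul, h2]
    linear_combination (-C a * C (1 / 2) * normLaguerre a n) * h1
  rw [diffMatrix_eq_gammaMoment ha, key, map_add, map_sub, map_add, gammaMoment_C_mul,
    gammaMoment_C_mul, gammaMoment_C_mul, gammaMoment_X_mul_mul_normLaguerre_of_degree_lt ha hm,
    gammaMoment_X_mul_mul_normLaguerre_of_degree_lt ha hm',
    gammaMoment_X_mul_mul_normLaguerre_of_degree_lt ha hd, gammaMoment_normLaguerre ha,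
    eval_zero_normLaguerre ha, Real.Gamma_add_one ha.ne', pow_add]
  have hG : 0 < Real.Gamma a := Real.Gamma_pos_of_pos ha
  have h1 := Real.sqrt_pos.2 (gammaGrowth_pos ha n)
  field_simp
  ring

/-! ### Growth of `gammaGrowth` -/

theorem Gamma_add_one_add_nat {a : ℝ} (ha : 0 < a) (n : ℕ) :
    Real.Gamma (a + 1 + n) = Real.Gamma a * ∏ j ∈ Finset.range (n + 1), (a + j) := by
  induction n with
  | zero => simp [Real.Gamma_add_one ha.ne', mul_comm]
  | succ n ih =>
    have h : a + 1 + n ≠ 0 := by positivity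
    rw [Finset.prod_range_succ, ← mul_assoc, ← ih, Nat.cast_succ, ← add_assoc,
      Real.Gamma_add_one h]
    ring

/-- Turns Euler's limit `GammaSeq a n → Γ(a)` into the two-sided comparison of `gammaGrowth a n`
with `n ^ a`. -/
theorem gammaGrowth_mul_GammaSeq {a : ℝ} (ha : 0 < a) (n : ℕ) :
    gammaGrowth a n * Real.GammaSeq a n = Real.Gamma a * (n : ℝ) ^ a := by
  have h : 0 < ∏ j ∈ Finset.range (n + 1), (a + j) := Finset.prod_pos fun _ _ => by positivity
  rw [gammaGrowth, Real.GammaSeq, Gamma_add_one_add_nat ha]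
  field_simp

theorem eventually_gammaGrowth_bounds {a : ℝ} (ha : 0 < a) :
    ∀ᶠ n : ℕ in atTop, (n : ℝ) ^ a / 2 ≤ gammaGrowth a n ∧ gammaGrowth a n ≤ 2 * (n : ℝ) ^ a := by
  have hG := Real.Gamma_pos_of_pos ha
  have ht := Real.GammaSeq_tendsto_Gamma a
  filter_upwards [ht.eventually_lt_const (show Real.Gamma a < 2 * Real.Gamma a by linarith),
    ht.eventually_const_lt (show Real.Gamma a / 2 < Real.Gamma a by linarith)] with n h1 h2
  have h := gammaGrowth_mul_GammaSeq ha n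
  have hg := gammaGrowth_pos ha n
  constructor
  · have : gammaGrowth a n * Real.GammaSeq a n ≤ gammaGrowth a n * (2 * Real.Gamma a) := by gcongr
    rw [h] at this
    refine le_of_mul_le_mul_left ?_ hG
    linarith
  · have : gammaGrowth a n * (Real.Gamma a / 2) ≤ gammaGrowth a n * Real.GammaSeq a n := by gcongr
    rw [h] at this
    refine le_of_mul_le_mul_left ?_ hG
    linarith

theorem gammaGrowth_monotone {a : ℝ} (ha : 0 < a) : Monotone (gammaGrowth a) := by
  refine monotone_nat_of_le_succ fun n => ?_
  have h : a + 1 + n ≠ 0 := by positivity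
  have hG : 0 < Real.Gamma (a + 1 + n) := Real.Gamma_pos_of_pos (by positivity)
  rw [gammaGrowth, gammaGrowth, Nat.factorial_succ, Nat.cast_succ, ← add_assoc,
    Real.Gamma_add_one h, div_le_div_iff₀ (by positivity) (by positivity)]
  push_cast
  have : 0 ≤ Real.Gamma (a + 1 + n) * n.factorial * a := by positivity
  linarith

theorem summable_const_div_gammaGrowth_rpow {a b C : ℝ} (ha : 0 < a) (hb : 0 < b)
    (hab : 1 < a * b) (hC : 0 ≤ C) : Summable fun n => (C / gammaGrowth a n) ^ b := by
  refine summable_of_isBigO_nat (Real.summable_nat_rpow.2 (show -(a * b) < -1 by linarith)) ?_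
  refine Asymptotics.IsBigO.of_bound ((2 * C) ^ b) ?_
  filter_upwards [eventually_gammaGrowth_bounds ha, eventually_gt_atTop 0] with n hn hn0
  have hn0 : (0 : ℝ) < n := by exact_mod_cast hn0
  have hg := gammaGrowth_pos ha n
  have hna : 0 < (n : ℝ) ^ a := Real.rpow_pos_of_pos hn0 a
  rw [Real.norm_of_nonneg (by positivity), Real.norm_of_nonneg (by positivity), neg_mul_eq_neg_mul,
    Real.rpow_mul hn0.le, ← Real.mul_rpow (by positivity) (by positivity)]
  refine Real.rpow_le_rpow (by positivity) ?_ hb.le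
  rw [Real.rpow_neg hn0.le, ← div_eq_mul_inv, div_le_div_iff₀ hg hna]
  nlinarith [hn.1]

/-! ### Absolute convergence for `r < a` -/

theorem summable_prod_pi_of_nonneg {f : ℕ → ℝ} (hf : Summable f) (h0 : ∀ n, 0 ≤ f n) (r : ℕ) :
    Summable fun j : Fin r → ℕ => ∏ i, f (j i) := by
  induction r with
  | zero => exact Summable.of_finite
  | succ r ih =>
    rw [← (Fin.consEquiv fun _ => ℕ).summable_iff]
    have := hf.mul_of_nonneg ih h0 fun j => Finset.prod_nonneg fun i _ => h0 (j i)
    refine this.congr fun x => ?_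
    simp [Fin.consEquiv, Fin.prod_univ_succ]

theorem abs_diffMatrix_le {a : ℝ} (ha : 0 < a) (m n : ℕ) :
    |diffMatrix (Ioi 0) (laguerreWeight a) m n| ≤ √(gammaGrowth a m) / √(gammaGrowth a n) := by
  have hlt : ∀ {m n : ℕ}, m < n → |diffMatrix (Ioi 0) (laguerreWeight a) m n| ≤
      √(gammaGrowth a m) / √(gammaGrowth a n) := by
    intro m n h
    have : 0 ≤ √(gammaGrowth a m) / √(gammaGrowth a n) := by positivity
    rw [diffMatrix_laguerreWeight_of_lt ha h, abs_mul, abs_mul, abs_of_nonneg this, abs_pow]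
    norm_num
    linarith
  rcases lt_trichotomy m n with h | rfl | h
  · exact hlt h
  · have := diffMatrix_laguerreWeight_antisymm ha m m
    rw [show diffMatrix (Ioi 0) (laguerreWeight a) m m = 0 by linarith, abs_zero]
    positivity
  · rw [diffMatrix_laguerreWeight_antisymm ha, abs_neg]
    refine (hlt h).trans ?_
    have hs : √(gammaGrowth a n) ≤ √(gammaGrowth a m) :=
      Real.sqrt_le_sqrt (gammaGrowth_monotone ha h.le)
    have h1 := Real.sqrt_pos.2 (gammaGrowth_pos ha n)
    have h2 := Real.sqrt_pos.2 (gammaGrowth_pos ha m)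
    rw [div_le_div_iff₀ h2 h1]
    nlinarith

/-- Telescoping from both ends: edges before vertex `i` are bounded by `h1`, giving `h (v 0) / h (v
i)`, and edges after it by `h2`, giving `h (v (Fin.last N)) / h (v i)`. -/
theorem prod_abs_le_of_abs_le_div {D : ℕ → ℕ → ℝ} {h : ℕ → ℝ} (hpos : ∀ n, 0 < h n)
    (h1 : ∀ m n, |D m n| ≤ h m / h n) (h2 : ∀ m n, |D m n| ≤ h n / h m) {N : ℕ}
    (v : Fin (N + 1) → ℕ) (i : Fin (N + 1)) :
    ∏ k : Fin N, |D (v k.castSucc) (v k.succ)| ≤ h (v 0) * h (v (Fin.last N)) / h (v i) ^ 2 := by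
  induction N with
  | zero =>
    have := hpos (v 0)
    obtain rfl : i = 0 := Fin.eq_zero i
    simp [← sq, this.ne']
  | succ N ih =>
    have ih := ih (fun k => v k.succ)
    rw [Fin.prod_univ_succ]
    have p0 := hpos (v 0)
    have p1 := hpos (v 1)
    have pl := hpos (v (Fin.last (N + 1)))
    cases i using Fin.cases with
    | zero =>
      calc _ ≤ h (v 1) / h (v 0) *
            (h (v 1) * h (v (Fin.last (N + 1))) / h (v 1) ^ 2) :=
            mul_le_mul (h2 _ _) (ih 0) (Finset.prod_nonneg fun _ _ => abs_nonneg _) (by positivity)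
        _ = _ := by field_simp
    | succ i =>
      have pi := hpos (v i.succ)
      calc _ ≤ h (v 0) / h (v 1) *
            (h (v 1) * h (v (Fin.last (N + 1))) / h (v i.succ) ^ 2) :=
            mul_le_mul (h1 _ _) (ih i) (Finset.prod_nonneg fun _ _ => abs_nonneg _) (by positivity)
        _ = _ := by field_simp

theorem abs_diffMatrix_le' {a : ℝ} (ha : 0 < a) (m n : ℕ) :
    |diffMatrix (Ioi 0) (laguerreWeight a) m n| ≤ √(gammaGrowth a n) / √(gammaGrowth a m) := by
  rw [diffMatrix_laguerreWeight_antisymm ha, abs_neg]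
  exact abs_diffMatrix_le ha n m

theorem abs_pathProd_le {a : ℝ} (ha : 0 < a) {r : ℕ} (m n : ℕ) (j : Fin r → ℕ) (i : Fin r) :
    |pathProd (diffMatrix (Ioi 0) (laguerreWeight a)) r m n j| ≤
      √(gammaGrowth a m) * √(gammaGrowth a n) / gammaGrowth a (j i) := by
  rw [pathProd, Finset.abs_prod]
  have h := prod_abs_le_of_abs_le_div (fun k => Real.sqrt_pos.2 (gammaGrowth_pos ha k))
    (abs_diffMatrix_le ha) (abs_diffMatrix_le' ha)
    (Fin.cons (α := fun _ => ℕ) m (Fin.snoc (α := fun _ => ℕ) j n)) i.castSucc.succ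
  rw [Fin.cons_zero, Fin.cons_succ, Fin.snoc_castSucc, ← Fin.succ_last, Fin.cons_succ,
    Fin.snoc_last, Real.sq_sqrt (gammaGrowth_pos ha _).le] at h
  exact h

theorem powAbsBounded_diffMatrix_laguerreWeight {a : ℝ} (ha : 0 < a) {r : ℕ} (hr : (r : ℝ) < a) :
    PowAbsBounded (diffMatrix (Ioi 0) (laguerreWeight a)) (r + 1) := by
  intro m n
  rcases Nat.eq_zero_or_pos r with rfl | hr0
  · exact Summable.of_finite
  have hr0' : (0 : ℝ) < r := by exact_mod_cast hr0
  set C := √(gammaGrowth a m) * √(gammaGrowth a n)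
  have hs := summable_const_div_gammaGrowth_rpow (b := 1 / r) (C := C) ha (by positivity)
    (by rw [mul_one_div, one_lt_div hr0']; exact hr) (by positivity)
  refine Summable.of_nonneg_of_le (fun _ => abs_nonneg _) (fun j => ?_)
    (summable_prod_pi_of_nonneg hs (fun k => ?_) r)
  · set P := |pathProd (diffMatrix (Ioi 0) (laguerreWeight a)) r m n j| with hP
    have hP0 : 0 ≤ P := abs_nonneg _
    -- Geometric mean: the `i`-th copy of `P ^ (1 / r)` is estimated by the bound at the vertex `j
    -- i`, which separates the variables.
    calc P = ∏ i : Fin r, P ^ (1 / r : ℝ) := by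
          rw [Finset.prod_const, Finset.card_univ, Fintype.card_fin, ← Real.rpow_natCast,
            ← Real.rpow_mul hP0, one_div_mul_cancel hr0'.ne', Real.rpow_one]
      _ ≤ _ := Finset.prod_le_prod (fun _ _ => by positivity) fun i _ =>
          Real.rpow_le_rpow hP0 (abs_pathProd_le ha m n j i) (by positivity)
  · have := gammaGrowth_pos ha k
    positivity

/-- Every finite set of multi-indices lies in a box, so boxes are cofinal for unconditional
summation. -/
theorem PowAbsBounded.powBounded {D : ℕ → ℕ → ℝ} {k : ℕ} (h : PowAbsBounded D k) :
    PowBounded D k := by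
  cases k with
  | zero => trivial
  | succ r =>
    intro m n
    refine ⟨_, ((h m n).of_abs.hasSum).comp (tendsto_atTop.2 fun s => ?_)⟩
    filter_upwards [eventually_ge_atTop fun i => s.sup (fun j => j i) + 1] with N hN
    intro j hj
    refine Fintype.mem_piFinset.2 fun i => Finset.mem_range.2 ?_
    exact (Nat.lt_succ_of_le (Finset.le_sup (f := fun j => j i) hj)).trans_le (hN i)

/-! ### Divergence for `a ≤ r` -/

/-- The box with sides `[M i, N i)` for `i ∈ A` and `[0, N i)` for `i ∉ A`. -/
def mixedBox {r : ℕ} (A : Finset (Fin r)) (M N : Fin r → ℕ) : Finset (Fin r → ℕ) :=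
  Fintype.piFinset fun i => if i ∈ A then Finset.Ico (M i) (N i) else Finset.range (N i)

theorem mem_mixedBox {r : ℕ} {A : Finset (Fin r)} {M N j : Fin r → ℕ} :
    j ∈ mixedBox A M N ↔ ∀ i, j i < N i ∧ (i ∈ A → M i ≤ j i) := by
  refine Fintype.mem_piFinset.trans (forall_congr' fun i => ?_)
  by_cases h : i ∈ A <;> simp [h, and_comm]

theorem sum_mixedBox_insert {r : ℕ} {A : Finset (Fin r)} {b : Fin r} (hb : b ∉ A)
    {M N : Fin r → ℕ} (hMN : M b ≤ N b) (f : (Fin r → ℕ) → ℝ) :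
    ∑ j ∈ mixedBox (insert b A) M N, f j =
      ∑ j ∈ mixedBox A M N, f j - ∑ j ∈ mixedBox A M (Function.update N b (M b)), f j := by
  rw [eq_sub_iff_add_eq,
    ← Finset.sum_filter_not_add_sum_filter (mixedBox A M N) (fun j => j b < M b)]
  congr 2
  · ext j
    simp only [mem_mixedBox, Finset.mem_filter, Finset.mem_insert]
    constructor
    · exact fun h => ⟨fun i => ⟨(h i).1, fun hi => (h i).2 (Or.inr hi)⟩,
        not_lt.2 ((h b).2 (Or.inl rfl))⟩
    · rintro ⟨h, h'⟩ i
      refine ⟨(h i).1, ?_⟩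
      rintro (rfl | hi)
      · exact not_lt.1 h'
      · exact (h i).2 hi
  · ext j
    simp only [mem_mixedBox, Finset.mem_filter]
    constructor
    · intro h
      have hjb : j b < M b := by simpa using (h b).1
      refine ⟨fun i => ⟨?_, (h i).2⟩, hjb⟩
      rcases eq_or_ne i b with rfl | hi
      · exact hjb.trans_le hMN
      · simpa [hi] using (h i).1
    · rintro ⟨h, h'⟩ i
      refine ⟨?_, (h i).2⟩
      rcases eq_or_ne i b with rfl | hi
      · simpa using h'
      · simpa [hi] using (h i).1

/-- Cauchy criterion for multiple series. Cutting `[0, M b)` off one side gives a difference of two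
box sums whose upper corners both tend to infinity, so their limits cancel. Convergence with
independent `N i` is essential here. -/
theorem tendsto_sum_mixedBox {r : ℕ} {f : (Fin r → ℕ) → ℝ} {L : ℝ}
    (hf : Tendsto (fun N : Fin r → ℕ => ∑ j ∈ Fintype.piFinset (fun i => Finset.range (N i)), f j)
      atTop (𝓝 L)) (A : Finset (Fin r)) {M N : ℕ → Fin r → ℕ} (hM : Tendsto M atTop atTop)
    (hN : Tendsto N atTop atTop) (hMN : ∀ k, M k ≤ N k) :
    Tendsto (fun k => ∑ j ∈ mixedBox A (M k) (N k), f j) atTop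
      (𝓝 (if A.Nonempty then 0 else L)) := by
  induction A using Finset.induction_on generalizing N with
  | empty =>
    simpa [mixedBox, Function.comp_def] using hf.comp hN
  | insert b A hb ih =>
    have h2 : Tendsto (fun k => Function.update (N k) b (M k b)) atTop atTop := by
      refine tendsto_atTop_mono (fun k i => ?_) hM
      rcases eq_or_ne i b with rfl | hi
      · simp
      · simpa [hi] using hMN k i
    have h := (ih hN hMN).sub (ih h2 fun k i => by
      rcases eq_or_ne i b with rfl | hi
      · simp
      · simpa [hi] using hMN k i)
    rw [sub_self] at h
    simpa [sum_mixedBox_insert hb (hMN _ b)] using h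

theorem prod_diffMatrix_of_strictMono {a : ℝ} (ha : 0 < a) {N : ℕ} {v : Fin (N + 1) → ℕ}
    (hv : StrictMono v) :
    ∏ k : Fin N, diffMatrix (Ioi 0) (laguerreWeight a) (v k.castSucc) (v k.succ) =
      (1 / 2) ^ N * (-1) ^ (v 0 + v (Fin.last N)) *
        (√(gammaGrowth a (v 0)) / √(gammaGrowth a (v (Fin.last N)))) := by
  have hpos := fun k => Real.sqrt_pos.2 (gammaGrowth_pos ha k)
  induction N with
  | zero =>
    have := hpos (v 0)
    simp [← two_mul, this.ne']
  | succ N ih =>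
    have ih := ih (v := fun k => v k.succ) (hv.comp Fin.strictMono_succ)
    have hlt : v 0 < v 1 := hv (by simp)
    have h1 := hpos (v 1)
    have h2 := hpos (v (Fin.last (N + 1)))
    have hs : ((-1 : ℝ) ^ v 1) * (-1) ^ v 1 = 1 := by rw [← mul_pow]; norm_num
    rw [Fin.prod_univ_succ]
    refine (congrArg₂ (· * ·) (diffMatrix_laguerreWeight_of_lt ha hlt) ih).trans ?_
    simp only [Fin.succ_zero_eq_one, Fin.succ_last, pow_add, pow_one]
    field_simp
    linear_combination √(gammaGrowth a (v 0)) * hs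

/-- The increasing part telescopes to a multiple of `h_0 / h_{j_r}`; the return edge to `0` supplies
the same ratio and sign again, with a minus from antisymmetry. Hence no cancellation among these
terms. -/
theorem pathProd_diffMatrix_of_strictMono {a : ℝ} (ha : 0 < a) {r : ℕ} {j : Fin (r + 1) → ℕ}
    (hj : StrictMono j) (h0 : 0 < j 0) :
    pathProd (diffMatrix (Ioi 0) (laguerreWeight a)) (r + 1) 0 0 j =
      -((1 / 2) ^ (r + 2) * gammaGrowth a 0 / gammaGrowth a (j (Fin.last r))) := by
  have hv : StrictMono (Fin.cons (α := fun _ => ℕ) 0 j : Fin (r + 2) → ℕ) := by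
    refine Fin.strictMono_iff_lt_succ.2 fun i => ?_
    cases i using Fin.cases with
    | zero => simpa using h0
    | succ i =>
      rw [← Fin.succ_castSucc, Fin.cons_succ, Fin.cons_succ]
      exact hj (Fin.castSucc_lt_succ)
  have h := prod_diffMatrix_of_strictMono ha hv
  have hl : 0 < j (Fin.last r) := h0.trans_le (hj.monotone (Fin.zero_le _))
  have hlast := diffMatrix_laguerreWeight_antisymm ha (j (Fin.last r)) 0
  rw [diffMatrix_laguerreWeight_of_lt ha hl] at hlast
  rw [pathProd, Fin.prod_univ_castSucc]
  simp only [Fin.cons_snoc_eq_snoc_cons, Fin.succ_castSucc, Fin.snoc_castSucc, Fin.succ_last,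
    Fin.snoc_last]
  rw [← Fin.succ_last, Fin.cons_succ, Fin.cons_zero] at h
  rw [← Fin.succ_last, Fin.cons_succ, hlast]
  have hs : ((-1 : ℝ) ^ j (Fin.last r)) * (-1) ^ j (Fin.last r) = 1 := by
    rw [← mul_pow]
    norm_num
  have hg := Real.mul_self_sqrt (gammaGrowth_pos ha 0).le
  have hgl := Real.mul_self_sqrt (gammaGrowth_pos ha (j (Fin.last r))).le
  have hpos := Real.sqrt_pos.2 (gammaGrowth_pos ha (j (Fin.last r)))
  refine (congrArg (· * _) h).trans ?_
  simp only [zero_add]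
  generalize √(gammaGrowth a 0) = x at hg ⊢
  generalize √(gammaGrowth a (j (Fin.last r))) = y at hgl hpos ⊢
  rw [← hg, ← hgl]
  field_simp
  linear_combination (-(1 / 2 : ℝ) ^ (r + 1) * x ^ 2) * hs

theorem not_powBounded_diffMatrix_laguerreWeight {a : ℝ} (ha : 0 < a) {r : ℕ} (hr : a ≤ r) :
    ¬ PowBounded (diffMatrix (Ioi 0) (laguerreWeight a)) (r + 1) := by
  intro hb
  obtain ⟨L, hL⟩ := hb 0 0
  rcases r with _ | r
  · exact absurd hr (by simpa using ha)
  -- The sides `[(i+1)K, (i+2)K)` are consecutive blocks of length `K`, so every tuple in the box is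
  -- strictly increasing, with positive first entry once `K ≥ 1`.
  set M : ℕ → Fin (r + 1) → ℕ := fun K i => (i + 1) * K
  set N : ℕ → Fin (r + 1) → ℕ := fun K i => (i + 2) * K
  have hM : Tendsto M atTop atTop := tendsto_atTop_mono
    (fun K i => Nat.le_mul_of_pos_left K i.1.succ_pos)
    (tendsto_atTop_atTop.2 fun b => ⟨Finset.univ.sup b, fun K hK i =>
      (Finset.le_sup (Finset.mem_univ i)).trans hK⟩ : Tendsto (fun K (_ : Fin (r + 1)) => K) _ _)
  have hMN : ∀ K, M K ≤ N K := fun K i => Nat.mul_le_mul_right K (by omega)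
  have ht := tendsto_sum_mixedBox hL Finset.univ hM (tendsto_atTop_mono hMN hM) hMN
  rw [if_pos Finset.univ_nonempty] at ht
  have hg0 := gammaGrowth_pos ha 0
  -- The last index is below `(r+2)K`, so `gammaGrowth` there is at most `2 (r+2)^a K^a ≤ 2 (r+2)^a
  -- K^(r+1)`. With `K ^ (r+1)` terms, the box sum is at most `-c`.
  set c : ℝ := (1 / 2) ^ (r + 2) * gammaGrowth a 0 / (2 * (r + 2 : ℝ) ^ a)
  have hc : 0 < c := by positivity
  obtain ⟨K₀, hK₀⟩ := eventually_atTop.1 (eventually_gammaGrowth_bounds ha)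
  refine absurd (le_of_tendsto ht ?_) (not_le.2 (neg_lt_zero.2 hc))
  filter_upwards [eventually_ge_atTop K₀, eventually_ge_atTop 1] with K hK hK1
  have hK1' : (1 : ℝ) ≤ K := by exact_mod_cast hK1
  have hK0' : (0 : ℝ) < K := by linarith
  have hterm : ∀ j ∈ mixedBox Finset.univ (M K) (N K),
      pathProd (diffMatrix (Ioi 0) (laguerreWeight a)) (r + 1) 0 0 j ≤ -(c / K ^ (r + 1)) := by
    intro j hj
    rw [mem_mixedBox] at hj
    have hmono : StrictMono j := Fin.strictMono_iff_lt_succ.2 fun i =>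
      (hj i.castSucc).1.trans_le ((hj i.succ).2 (Finset.mem_univ _))
    have h0 : 0 < j 0 := by
      refine lt_of_lt_of_le ?_ ((hj 0).2 (Finset.mem_univ _))
      simpa [M] using Nat.lt_of_succ_le hK1
    rw [pathProd_diffMatrix_of_strictMono ha hmono h0, neg_le_neg_iff, div_div]
    have hg := gammaGrowth_pos ha (j (Fin.last r))
    refine div_le_div_of_nonneg_left (by positivity) hg ?_
    calc gammaGrowth a (j (Fin.last r)) ≤ gammaGrowth a ((r + 2) * K) :=
          gammaGrowth_monotone ha (hj (Fin.last r)).1.le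
      _ ≤ 2 * (((r + 2) * K : ℕ) : ℝ) ^ a :=
          (hK₀ _ (hK.trans (Nat.le_mul_of_pos_left K (by omega)))).2
      _ = 2 * (r + 2 : ℝ) ^ a * (K : ℝ) ^ a := by
          push_cast
          rw [Real.mul_rpow (by positivity) hK0'.le, mul_assoc]
      _ ≤ 2 * (r + 2 : ℝ) ^ a * (K : ℝ) ^ (r + 1) := by
          rw [← Real.rpow_natCast (K : ℝ) (r + 1)]
          gcongr
  refine (Finset.sum_le_card_nsmul _ _ _ hterm).trans_eq ?_
  have hcard : (mixedBox Finset.univ (M K) (N K)).card = K ^ (r + 1) := by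
    rw [mixedBox, Fintype.card_piFinset]
    simp [M, N, ← Nat.sub_mul]
  rw [hcard, nsmul_eq_mul]
  push_cast
  field_simp

/-! ### The index and the conclusion -/

theorem natCast_le_index_iff {I : Set ℝ} {w : ℝ → ℝ} {s : ℕ} : (s : ℕ∞) ≤ index I w ↔
    ∀ k : ℕ, 1 ≤ k → k ≤ s → EntriesExist I w ∧ PowBounded (diffMatrix I w) k := by
  constructor
  · intro h
    by_contra! hk
    obtain ⟨k, hk1, hks, hk⟩ := hk
    -- A failing power `k` keeps every admissible `t`, hence the supremum, at or below `k - 1`.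
    have h2 : index I w ≤ ((k - 1 : ℕ) : ℕ∞) := by
      refine sSup_le fun t ht => ?_
      by_contra! hlt
      have hkt : (k : ℕ∞) ≤ t := by
        have := Order.add_one_le_of_lt hlt
        rwa [← Nat.cast_add_one, Nat.sub_add_cancel hk1] at this
      exact hk (ht k hk1 hkt).1 (ht k hk1 hkt).2
    have h3 : s ≤ k - 1 := by exact_mod_cast h.trans h2
    omega
  · exact fun h => le_sSup fun k hk1 hks => h k hk1 (by exact_mod_cast hks)

end WFun

end

theorem theorem7 (α : ℝ) (hα : 0 < α) (s : ℕ) :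
    ((s : ℕ∞) ≤ WFun.index (Set.Ioi 0) (WFun.laguerreWeight α) ↔ (s : ℝ) - 1 < α) ∧
    ((s : ℝ) - 1 < α → ∀ k : ℕ, 1 ≤ k → k ≤ s →
      WFun.PowAbsBounded (WFun.diffMatrix (Set.Ioi 0) (WFun.laguerreWeight α)) k) := by
  have habs : (s : ℝ) - 1 < α → ∀ k : ℕ, 1 ≤ k → k ≤ s →
      WFun.PowAbsBounded (WFun.diffMatrix (Set.Ioi 0) (WFun.laguerreWeight α)) k := by
    intro hs k hk1 hks
    obtain ⟨r, rfl⟩ := Nat.exists_eq_add_of_le' hk1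
    refine WFun.powAbsBounded_diffMatrix_laguerreWeight hα (lt_of_le_of_lt ?_ hs)
    have : ((r + 1 : ℕ) : ℝ) ≤ s := by exact_mod_cast hks
    push_cast at this
    linarith
  refine ⟨?_, habs⟩
  rw [WFun.natCast_le_index_iff]
  constructor
  · intro h
    by_contra! hs
    rcases s with _ | r
    · norm_num at hs
      linarith
    · refine WFun.not_powBounded_diffMatrix_laguerreWeight hα ?_ (h (r + 1) (by omega) le_rfl).2
      push_cast at hs
      linarith
  · exact fun hs k hk1 hks =>
      ⟨WFun.entriesExist_laguerreWeight hα, (habs hs k hk1 hks).powBounded⟩
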